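/- An oriented graph is a finite directed graph with no loops, no parallel arcs and no directed cycles of length 2. Its clique number $\omega(D)$ is the largest number of pairwise adjacent vertices in its underlying undirected graph. Its dichromatic number $\vec{\chi}(D)$ is the least integer $k$ such that the vertex set of $D$ can be partitioned into $k$ (possibly empty) sets, each inducing a subdigraph with no directed cycle. Let $\vec{P}_6$ denote the directed path on six vertices. Theorem 1.3. Let $D$ be an oriented graph that contains no induced subdigraph isomorphic to $\vec{P}_6$ and satisfies $\omega(D) \le 2$. Then $\vec{\chi}(D) \le 382$. -/

import Mathlib

namespace Digraph

/-- An oriented graph: a digraph with no loops and no directed 2-cycles. (There are no parallel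
arcs, since a `Digraph` is a relation.) -/
structure IsOriented {V : Type*} (D : Digraph V) : Prop where
  no_loop : ∀ v, ¬ D.Adj v v
  no_two_cycle : ∀ u v, D.Adj u v → ¬ D.Adj v u

/-- The clique number of the underlying undirected graph, in which two distinct vertices are
adjacent if there is an arc between them in at least one direction. -/
noncomputable def cliqueNumber {V : Type*} (D : Digraph V) : ℕ :=
  D.toSimpleGraphInclusive.cliqueNum

/-- The subdigraph of `D` induced by a set `X` of vertices. -/
def induced {V : Type*} (D : Digraph V) (X : Set V) : Digraph X where
  Adj x y := D.Adj x y

/-- The directed path on the `k` vertices `0 → 1 → ⋯ → k - 1`. -/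
def directedPath (k : ℕ) : Digraph (Fin k) where
  Adj i j := i.val + 1 = j.val

/-- `D` contains no induced subdigraph isomorphic to `H`: no injective map of vertices
`W → V` preserves and reflects arcs. -/
def InducedFree {V W : Type*} (D : Digraph V) (H : Digraph W) : Prop :=
  IsEmpty (H.Adj ↪r D.Adj)

/-- `c 0 → c 1 → ⋯ → c (n - 1) → c 0` is a directed cycle of `D` of length `n ≥ 1`, the vertices
`c i` being pairwise distinct. The addition `i + 1` in `Fin n` is cyclic. -/
def IsDirectedCycle {V : Type*} (D : Digraph V) {n : ℕ} [NeZero n] (c : Fin n → V) : Prop :=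
  Function.Injective c ∧ ∀ i : Fin n, D.Adj (c i) (c (i + 1))

/-- `D` has no directed cycle. -/
def IsAcyclic {V : Type*} (D : Digraph V) : Prop :=
  ∀ (n : ℕ) [NeZero n] (c : Fin n → V), ¬ D.IsDirectedCycle c

/-- `D` has a `k`-dicolouring: the vertices can be partitioned into `k` (possibly empty) classes,
each inducing an acyclic subdigraph. -/
def Dicolourable {V : Type*} (D : Digraph V) (k : ℕ) : Prop :=
  ∃ f : V → Fin k, ∀ i : Fin k, (D.induced {v | f v = i}).IsAcyclic

/-- The dichromatic number: the least `k` such that `D` has a `k`-dicolouring (`⊤` if there is no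
such `k`). -/
noncomputable def dichromaticNumber {V : Type*} (D : Digraph V) : ℕ∞ :=
  ⨅ k ∈ {k : ℕ | D.Dicolourable k}, (k : ℕ∞)

end Digraph

namespace OrientedColouring

open Relation

variable {V : Type*}

/-- Adjacency in the underlying undirected graph. -/
def Nb (A : V → V → Prop) (u v : V) : Prop := A u v ∨ A v u

/-- Oriented, triangle-free relations in which no directed walk on six vertices is induced. -/
structure Good (A : V → V → Prop) : Prop where
  asymm : ∀ u v, A u v → ¬ A v u
  tri : ∀ a b c, Nb A a b → Nb A b c → Nb A a c → False
  p6 : ∀ a b c d e f, A a b → A b c → A c d → A d e → A e f →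
    ¬ Nb A a d → ¬ Nb A a e → ¬ Nb A a f → ¬ Nb A b e → ¬ Nb A b f → ¬ Nb A c f → False

/-- The restriction of a relation to a set. -/
def On (A : V → V → Prop) (X : Set V) (x y : V) : Prop := x ∈ X ∧ y ∈ X ∧ A x y

/-- No directed closed walk lies in `X`. -/
def Acyc (A : V → V → Prop) (X : Set V) : Prop := ∀ v, ¬ TransGen (On A X) v v

/-- `X` is covered by `n` acyclic colour classes. -/
def Dicol (A : V → V → Prop) (X : Set V) (n : ℕ) : Prop :=
  ∃ f : V → ℕ, (∀ x ∈ X, f x < n) ∧ ∀ i, Acyc A {x | x ∈ X ∧ f x = i}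

/-- `X` induces a strongly connected subdigraph. -/
def StrongOn (A : V → V → Prop) (X : Set V) : Prop :=
  ∀ x ∈ X, ∀ y ∈ X, ReflTransGen (On A X) x y

variable {A : V → V → Prop} {X Y T : Set V} {m n : ℕ}

theorem Nb.symm {u v : V} (h : Nb A u v) : Nb A v u := Or.symm h

theorem nb_comm {u v : V} : Nb A u v ↔ Nb A v u := Or.comm

theorem nb_flip {u v : V} : Nb (flip A) u v ↔ Nb A u v := Or.comm

theorem Good.flip (hA : Good A) : Good (flip A) where
  asymm u v h h' := hA.asymm u v h' h
  tri a b c h₁ h₂ h₃ := hA.tri a b c (nb_flip.1 h₁) (nb_flip.1 h₂) (nb_flip.1 h₃)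
  p6 a b c d e f h₁ h₂ h₃ h₄ h₅ n₁ n₂ n₃ n₄ n₅ n₆ := by
    simp only [nb_flip] at *
    exact hA.p6 f e d c b a h₅ h₄ h₃ h₂ h₁ (nb_comm.not.1 n₆) (nb_comm.not.1 n₅)
      (nb_comm.not.1 n₃) (nb_comm.not.1 n₄) (nb_comm.not.1 n₂) (nb_comm.not.1 n₁)

theorem Good.not_nb_of_nb_nb (hA : Good A) {a b c : V} (h₁ : Nb A a b) (h₂ : Nb A b c) :
    ¬ Nb A a c := fun h => hA.tri a b c h₁ h₂ h

theorem On.mono (h : X ⊆ Y) {x y : V} (hxy : On A X x y) : On A Y x y :=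
  ⟨h hxy.1, h hxy.2.1, hxy.2.2⟩

theorem Acyc.mono (hY : Acyc A Y) (h : X ⊆ Y) : Acyc A X :=
  fun v hv => hY v (TransGen.mono (fun _ _ => On.mono h) _ _ hv)

theorem Acyc.union (hX : Acyc A X) (hY : Acyc A Y) (h : ∀ x ∈ X, ∀ y ∈ Y, y ∉ X → ¬ A x y) :
    Acyc A (X ∪ Y) := by
  have fwd : ∀ a b, TransGen (On A (X ∪ Y)) a b → a ∈ X → b ∈ X ∧ TransGen (On A X) a b := by
    intro a b hab ha
    induction hab with
    | @single b h1 =>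
      have hb : b ∈ X := by
        by_contra hb
        exact h _ ha _ (h1.2.1.resolve_left hb) hb h1.2.2
      exact ⟨hb, .single ⟨ha, hb, h1.2.2⟩⟩
    | @tail b c _ h1 ih =>
      have hc : c ∈ X := by
        by_contra hb
        exact h _ ih.1 _ (h1.2.1.resolve_left hb) hb h1.2.2
      exact ⟨hc, ih.2.tail ⟨ih.1, hc, h1.2.2⟩⟩
  have bwd : ∀ a b, TransGen (On A (X ∪ Y)) a b → b ∉ X → a ∉ X ∧ TransGen (On A Y) a b := by
    intro a b hab hb
    have ha : a ∉ X := fun ha => hb (fwd a b hab ha).1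
    refine ⟨ha, ?_⟩
    induction hab with
    | single h1 => exact .single ⟨h1.1.resolve_left ha, h1.2.1.resolve_left hb, h1.2.2⟩
    | @tail b c h0 h1 ih =>
      have hc : b ∉ X := fun hc => by
        exact h _ hc _ (h1.2.1.resolve_left hb) hb h1.2.2
      exact (ih hc).tail ⟨h1.1.resolve_left hc, h1.2.1.resolve_left hb, h1.2.2⟩
  intro v hv
  by_cases hvX : v ∈ X
  · exact hX v (fwd v v hv hvX).2
  · exact hY v (bwd v v hv hvX).2

theorem Dicol.mono (hY : Dicol A Y m) (h : X ⊆ Y) (hmn : m ≤ n) : Dicol A X n := by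
  obtain ⟨f, hf, hac⟩ := hY
  exact ⟨f, fun x hx => (hf x (h hx)).trans_le hmn,
    fun i => (hac i).mono fun x hx => ⟨h hx.1, hx.2⟩⟩

theorem Dicol.subset (hY : Dicol A Y n) (h : X ⊆ Y) : Dicol A X n := hY.mono h le_rfl

theorem dicol_one_of_stable (h : ∀ x ∈ X, ∀ y ∈ X, ¬ A x y) : Dicol A X 1 := by
  refine ⟨fun _ => 0, fun _ _ => one_pos, fun i v hv => ?_⟩
  obtain ⟨w, hw : On A _ v w, -⟩ := TransGen.head'_iff.1 hv
  exact h _ hw.1.1 _ hw.2.1.1 hw.2.2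

theorem Dicol.union (hX : Dicol A X m) (hY : Dicol A Y n) : Dicol A (X ∪ Y) (m + n) := by
  classical
  obtain ⟨f, hf, hfa⟩ := hX
  obtain ⟨g, hg, hga⟩ := hY
  refine ⟨fun x => if x ∈ X then f x else m + g x, ?_, fun i => ?_⟩
  · intro x hx
    by_cases h : x ∈ X
    · simpa [h] using (hf x h).trans_le (Nat.le_add_right m n)
    · simpa [h] using hg x (hx.resolve_left h)
  · by_cases hi : i < m
    · refine (hfa i).mono ?_
      rintro x ⟨hx, hxi⟩
      by_cases h : x ∈ X
      · exact ⟨h, by simpa [h] using hxi⟩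
      · simp only [h, if_false] at hxi; omega
    · refine (hga (i - m)).mono ?_
      rintro x ⟨hx, hxi⟩
      by_cases h : x ∈ X
      · simp only [h, if_true] at hxi
        exact absurd (hf x h) (by omega)
      · simp only [h, if_false] at hxi
        exact ⟨hx.resolve_left h, by omega⟩

theorem Dicol.of_subset_union {Z : Set V} (h : Z ⊆ X ∪ Y) (hX : Dicol A X m)
    (hY : Dicol A Y n) : Dicol A Z (m + n) := (hX.union hY).subset h

/-- If no arc leaves `X` for `Y \ X`, then `X ∪ Y` needs no more colours than `X` and `Y`. -/
theorem Dicol.union_of_no_arc (hX : Dicol A X n) (hY : Dicol A Y n)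
    (h : ∀ x ∈ X, ∀ y ∈ Y, y ∉ X → ¬ A x y) : Dicol A (X ∪ Y) n := by
  classical
  obtain ⟨f, hf, hfa⟩ := hX
  obtain ⟨g, hg, hga⟩ := hY
  refine ⟨fun x => if x ∈ X then f x else g x, ?_, fun i => ?_⟩
  · intro x hx
    by_cases h : x ∈ X
    · simpa [h] using hf x h
    · simpa [h] using hg x (hx.resolve_left h)
  · have hY' : Acyc A {x | x ∈ Y ∧ x ∉ X ∧ g x = i} :=
      (hga i).mono fun x hx => ⟨hx.1, hx.2.2⟩
    refine ((hfa i).union hY' ?_).mono ?_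
    · exact fun x hx y hy _ => h x hx.1 y hy.1 hy.2.1
    · rintro x ⟨hx, hxi⟩
      by_cases h : x ∈ X
      · exact .inl ⟨h, by simpa [h] using hxi⟩
      · exact .inr ⟨hx.resolve_left h, h, by simpa [h] using hxi⟩

/-- Extension of a colouring over a dipolar set, given as the union of a set `P` that no arc
leaves for the rest and a set `Q` that no arc enters from the rest. -/
theorem Dicol.of_dipolar {P Q R : Set V} (hP : Dicol A P n) (hQ : Dicol A Q n)
    (hR : Dicol A R (n + n)) (hPR : ∀ x ∈ P, ∀ y ∈ R, ¬ A x y)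
    (hRQ : ∀ x ∈ R, ∀ y ∈ Q, ¬ A x y) (hX : X ⊆ P ∪ Q ∪ R) : Dicol A X (n + n) := by
  classical
  obtain ⟨f, hf, hfa⟩ := hP
  obtain ⟨g, hg, hga⟩ := hQ
  obtain ⟨e, he, hea⟩ := hR
  refine Dicol.subset (Y := P ∪ Q ∪ R)
    ⟨fun x => if x ∈ P then f x else if x ∈ Q then n + g x else e x, ?_, fun i => ?_⟩ hX
  · rintro x hx
    by_cases h : x ∈ P
    · have := hf x h
      simp only [h, if_true]; omega
    · by_cases h' : x ∈ Q
      · have := hg x h'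
        simp only [h, h', if_true, if_false]; omega
      · simpa [h, h'] using he x (hx.resolve_left fun h'' => h''.elim h h')
  · by_cases hi : i < n
    · refine ((hfa i).union (hea i) fun x hx y hy _ => hPR x hx.1 y hy.1).mono ?_
      rintro x ⟨hx, hxi⟩
      by_cases h : x ∈ P
      · exact .inl ⟨h, by simpa [h] using hxi⟩
      · by_cases h' : x ∈ Q
        · simp only [h, h', if_true, if_false] at hxi; omega
        · exact .inr ⟨hx.resolve_left fun h'' => h''.elim h h', by simpa [h, h'] using hxi⟩
    · refine ((hea i).union (hga (i - n)) fun x hx y hy _ => hRQ x hx.1 y hy.1).mono ?_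
      rintro x ⟨hx, hxi⟩
      by_cases h : x ∈ P
      · simp only [h, if_true] at hxi
        exact absurd (hf x h) (by omega)
      · by_cases h' : x ∈ Q
        · simp only [h, h', if_true, if_false] at hxi
          exact .inr ⟨h', by omega⟩
        · exact .inl ⟨hx.resolve_left fun h'' => h''.elim h h', by simpa [h, h'] using hxi⟩

theorem dicol_empty : Dicol A (∅ : Set V) n :=
  ⟨fun _ => 0, fun _ h => h.elim, fun _ v hv => by
    obtain ⟨w, hw, -⟩ := TransGen.head'_iff.1 hv
    exact hw.1.1⟩

theorem nonempty_of_not_dicol (h : ¬ Dicol A X n) : X.Nonempty := by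
  by_contra hX
  rw [Set.not_nonempty_iff_eq_empty] at hX
  exact h (hX ▸ dicol_empty)

theorem exists_strongOn [Finite V] (h : ¬ Dicol A X n) :
    ∃ M ⊆ X, StrongOn A M ∧ ¬ Dicol A M n := by
  obtain ⟨M, ⟨hMX, hM⟩, hmin⟩ := (Set.toFinite {M : Set V | M ⊆ X ∧ ¬ Dicol A M n}).exists_minimal
    ⟨X, subset_rfl, h⟩
  refine ⟨M, hMX, fun x hx y hy => ?_, hM⟩
  by_contra hxy
  set U : Set V := {z | z ∈ M ∧ ReflTransGen (On A M) x z} with hU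
  have hUM : U ⊆ M := fun z hz => hz.1
  have key : ∀ N ⊆ M, N ≠ M → Dicol A N n := by
    intro N hN hne
    by_contra hN'
    exact hne (hN.antisymm (hmin ⟨hN.trans hMX, hN'⟩ hN))
  have h1 : Dicol A U n := key U hUM fun e => hxy ((e ▸ hy : y ∈ U).2)
  have h2 : Dicol A (M \ U) n := key _ Set.sdiff_subset fun e => by
    have : x ∈ M \ U := by rw [e]; exact hx
    exact this.2 ⟨hx, .refl⟩
  apply hM
  refine (h1.union_of_no_arc h2 ?_).subset fun z hz => ?_
  · intro a ha b hb _ hab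
    exact hb.2 ⟨hb.1, ha.2.tail ⟨ha.1, hb.1, hab⟩⟩
  · by_cases hzU : z ∈ U
    · exact .inl hzU
    · exact .inr ⟨hz, hzU⟩

/-- `T` is a strong component of the subdigraph induced by `R`. -/
structure IsComp (A : V → V → Prop) (R T : Set V) : Prop where
  subset : T ⊆ R
  strong : StrongOn A T
  closed : ∀ x ∈ R, (∃ t ∈ T, A t x) → (∃ t ∈ T, ReflTransGen (On A R) x t) → x ∈ T

theorem exists_isComp [Finite V] (h : ¬ Dicol A X n) : ∃ T, IsComp A X T ∧ ¬ Dicol A T n := by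
  obtain ⟨M, hMX, hMs, hM⟩ := exists_strongOn h
  obtain ⟨x₀, hx₀⟩ := nonempty_of_not_dicol hM
  set T : Set V := {y | y ∈ X ∧ ReflTransGen (On A X) x₀ y ∧ ReflTransGen (On A X) y x₀} with hT
  refine ⟨T, ⟨fun y hy => hy.1, ?_, ?_⟩, fun hd => hM (hd.subset fun y hy => ?_)⟩
  · have key : ∀ x y, ReflTransGen (On A X) x y → x ∈ T → y ∈ T → ReflTransGen (On A T) x y := by
      intro x y hxy hx hy
      induction hxy using ReflTransGen.head_induction_on with
      | refl => exact .refl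
      | head h1 h2 ih =>
        have hc := ih ⟨h1.2.1, hx.2.1.tail h1, h2.trans hy.2.2⟩
        exact hc.head ⟨hx, ⟨h1.2.1, hx.2.1.tail h1, h2.trans hy.2.2⟩, h1.2.2⟩
    exact fun x hx y hy => key x y (hx.2.2.trans hy.2.1) hx hy
  · rintro x hx ⟨t, ht, htx⟩ ⟨t', ht', hxt⟩
    exact ⟨hx, ht.2.1.tail ⟨ht.1, hx, htx⟩, hxt.trans ht'.2.2⟩
  · exact ⟨hMX hy, ReflTransGen.mono (fun _ _ => On.mono hMX) _ _ (hMs x₀ hx₀ y hy),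
      ReflTransGen.mono (fun _ _ => On.mono hMX) _ _ (hMs y hy x₀ hx₀)⟩

theorem StrongOn.flip (h : StrongOn A X) : StrongOn (flip A) X := fun x hx y hy => by
  have := (reflTransGen_swap (r := On A X)).2 (h y hy x hx)
  exact ReflTransGen.mono (fun a b hab => ⟨hab.2.1, hab.1, hab.2.2⟩) _ _ this

theorem Dicol.of_flip (h : Dicol (flip A) X n) : Dicol A X n := by
  obtain ⟨f, hf, hfa⟩ := h
  refine ⟨f, hf, fun i v hv => hfa i v ?_⟩
  have := (transGen_swap (r := On A _)).2 hv
  exact TransGen.mono (fun a b hab => ⟨hab.2.1, hab.1, hab.2.2⟩) _ _ this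

theorem StrongOn.exists_succ (hA : Good A) (hT : StrongOn A T) (hd : ¬ Dicol A T 2)
    {x : V} (hx : x ∈ T) : ∃ y ∈ T, A x y := by
  by_contra! h
  refine hd (Dicol.mono (dicol_one_of_stable fun a ha b hb => ?_) subset_rfl one_le_two)
  have key : ∀ y ∈ T, y = x := fun y hy => by
    rcases ReflTransGen.cases_head (hT x hx y hy) with h' | ⟨c, h1, -⟩
    · exact h'.symm
    · exact absurd h1.2.2 (h c h1.2.1)
  rw [key a ha, key b hb]
  exact fun h' => hA.asymm _ _ h' h'

theorem StrongOn.exists_pred (hA : Good A) (hT : StrongOn A T) (hd : ¬ Dicol A T 2)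
    {x : V} (hx : x ∈ T) : ∃ y ∈ T, A y x :=
  hT.flip.exists_succ hA.flip (fun h => hd h.of_flip) hx

theorem exists_walk {x y : V} (h : ReflTransGen (On A X) x y) (hx : x ∈ X) :
    ∃ (n : ℕ) (w : ℕ → V), w 0 = x ∧ w n = y ∧ (∀ i < n, A (w i) (w (i + 1))) ∧
      ∀ i ≤ n, w i ∈ X := by
  induction h using ReflTransGen.head_induction_on with
  | refl => exact ⟨0, fun _ => y, rfl, rfl, fun i hi => by omega, fun _ _ => hx⟩
  | @head a c h1 _ ih =>
    obtain ⟨n, w, h0, hn, hs, hX⟩ := ih h1.2.1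
    refine ⟨n + 1, fun i => Nat.casesOn i a w, rfl, hn, ?_, ?_⟩
    · rintro (_ | i) hi
      · simpa [h0] using h1.2.2
      · exact hs i (by omega)
    · rintro (_ | i) hi
      · exact hx
      · exact hX i (by omega)

theorem dicol_nbhd (hA : Good A) (u : V) (X : Set V) : Dicol A {x | x ∈ X ∧ Nb A u x} 1 :=
  dicol_one_of_stable fun x hx y hy h => hA.tri u x y hx.2 (.inl h) hy.2

/-- Deleting the neighbourhood of a vertex lowers the number of colours by at most one. -/
theorem not_dicol_sdiff_nbhd (hA : Good A) (u : V) (h : ¬ Dicol A X (n + 1)) :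
    ¬ Dicol A {x | x ∈ X ∧ ¬ Nb A u x} n := fun hd =>
  h (Dicol.of_subset_union (fun x hx => by
    by_cases hu : Nb A u x
    · exact .inr ⟨hx, hu⟩
    · exact .inl ⟨hx, hu⟩) hd (dicol_nbhd hA u X))

/-- A vertex with an out-neighbour in a strong set that is not 2-dicolourable lies on a directed
4-cycle through that set, if its neighbourhood is closed in the following sense. -/
theorem exists_four_cycle {H : Set V} {x h : V} (hA : Good A) (hH : StrongOn A H)
    (hd : ¬ Dicol A H 2)
    (tight : ∀ z ∈ H, ∀ z' ∈ H, ∀ z'' ∈ H, A x z → A z z' → A z' z'' → Nb A x z'')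
    (hh : h ∈ H) (hxh : A x h) :
    ∃ p ∈ H, ∃ o ∈ H, ∃ m ∈ H, A x p ∧ A p o ∧ A o m ∧ A m x := by
  by_contra! hno
  have two : ∀ p ∈ H, ∀ o ∈ H, ∀ m ∈ H, A x p → A p o → A o m → A x m :=
    fun p hp o ho m hm h1 h2 h3 =>
      (tight p hp o ho m hm h1 h2 h3).resolve_right (hno p hp o ho m hm h1 h2 h3)
  have key : ∀ y, ReflTransGen (On A H) h y → A x y ∨ ∃ p ∈ H, A x p ∧ A p y := by
    intro y hy
    induction hy with
    | refl => exact .inl hxh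
    | tail _ h1 ih =>
      rcases ih with ih | ⟨p, hp, h2, h3⟩
      · exact .inr ⟨_, h1.1, ih, h1.2.2⟩
      · exact .inl (two p hp _ h1.1 _ h1.2.1 h2 h3 h1.2.2)
  apply hd
  refine Dicol.of_subset_union (X := {y | y ∈ H ∧ Nb A x y}) (Y := {y | y ∈ H ∧ ¬ A x y})
    (m := 1) (n := 1) (fun y hy => ?_) (dicol_nbhd hA x H) (dicol_one_of_stable ?_)
  · by_cases hxy : A x y
    · exact .inl ⟨hy, .inl hxy⟩
    · exact .inr ⟨hy, hxy⟩
  · rintro y ⟨hy, hxy⟩ z ⟨hz, hxz⟩ hyz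
    obtain ⟨p, hp, h2, h3⟩ := (key y (hH h hh y hy)).resolve_left hxy
    exact hxz (two p hp y hy z hz h2 h3 hyz)

/-- A directed walk `k' → k → x` with `k`, `k'` not adjacent to `H`. -/
structure InRoot (A : V → V → Prop) (H : Set V) (x : V) (k k' : V) : Prop where
  arc : A k x
  arc' : A k' k
  nb : ∀ h ∈ H, ¬ Nb A k h
  nb' : ∀ h ∈ H, ¬ Nb A k' h

theorem InRoot.tight {H : Set V} {x k k' : V} (hA : Good A) (h : InRoot A H x k k') :
    ∀ z ∈ H, ∀ z' ∈ H, ∀ z'' ∈ H, A x z → A z z' → A z' z'' → Nb A x z'' := by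
  intro z hz z' hz' z'' hz'' h1 h2 h3
  by_contra hn
  exact hA.p6 k' k x z z' z'' h.arc' h.arc h1 h2 h3 (h.nb' z hz) (h.nb' z' hz') (h.nb' z'' hz'')
    (h.nb z' hz') (h.nb z'' hz'') hn

/-- A directed walk `x → s → s'` with `s`, `s'` not adjacent to `H`. -/
abbrev OutRoot (A : V → V → Prop) (H : Set V) (x : V) (s s' : V) : Prop :=
  InRoot (flip A) H x s s'

theorem OutRoot.mk' {H : Set V} {x s s' : V} (h1 : A x s) (h2 : A s s')
    (h3 : ∀ h ∈ H, ¬ Nb A s h) (h4 : ∀ h ∈ H, ¬ Nb A s' h) : OutRoot A H x s s' :=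
  ⟨h1, h2, fun y hy h => h3 y hy (nb_flip.1 h), fun y hy h => h4 y hy (nb_flip.1 h)⟩

theorem OutRoot.tight {H : Set V} {x s s' : V} (hA : Good A) (h : OutRoot A H x s s') :
    ∀ z ∈ H, ∀ z' ∈ H, ∀ z'' ∈ H, A z x → A z' z → A z'' z' → Nb A x z'' :=
  fun z hz z' hz' z'' hz'' h1 h2 h3 =>
    nb_flip.1 (InRoot.tight hA.flip h z hz z' hz' z'' hz'' h1 h2 h3)

theorem InRoot.exists_four_cycle {H : Set V} {x k k' h : V} (hA : Good A)
    (hr : InRoot A H x k k') (hH : StrongOn A H) (hd : ¬ Dicol A H 2) (hh : h ∈ H)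
    (hxh : A x h) : ∃ p ∈ H, ∃ o ∈ H, ∃ m ∈ H, A x p ∧ A p o ∧ A o m ∧ A m x :=
  OrientedColouring.exists_four_cycle hA hH hd (hr.tight hA) hh hxh

theorem OutRoot.exists_four_cycle {H : Set V} {x s s' h : V} (hA : Good A)
    (hr : OutRoot A H x s s') (hH : StrongOn A H) (hd : ¬ Dicol A H 2) (hh : h ∈ H)
    (hxh : A h x) : ∃ p ∈ H, ∃ o ∈ H, ∃ m ∈ H, A x p ∧ A p o ∧ A o m ∧ A m x := by
  obtain ⟨p, hp, o, ho, m, hm, h1, h2, h3, h4⟩ :=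
    InRoot.exists_four_cycle hA.flip hr hH.flip (fun h => hd h.of_flip) hh hxh
  exact ⟨m, hm, o, ho, p, hp, h4, h3, h2, h1⟩

/-- `W` dominates `H`, its vertices are pairwise nonadjacent, and directed walks of length three
between `H` and a vertex of `W` have adjacent ends. -/
structure TightCover (A : V → V → Prop) (H W : Set V) : Prop where
  fwd : ∀ u ∈ W, ∀ z ∈ H, ∀ z' ∈ H, ∀ z'' ∈ H, A u z → A z z' → A z' z'' → Nb A u z''
  bwd : ∀ u ∈ W, ∀ z ∈ H, ∀ z' ∈ H, ∀ z'' ∈ H, A z u → A z' z → A z'' z' → Nb A u z''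
  stable : ∀ u ∈ W, ∀ w ∈ W, ¬ Nb A u w
  dom : ∀ h ∈ H, ∃ u ∈ W, A u h

namespace TightCover

variable {H W : Set V}

theorem mono (hC : TightCover A H W) (h : X ⊆ H) : TightCover A X W where
  fwd u hu z hz z' hz' z'' hz'' := hC.fwd u hu z (h hz) z' (h hz') z'' (h hz'')
  bwd u hu z hz z' hz' z'' hz'' := hC.bwd u hu z (h hz) z' (h hz') z'' (h hz'')
  stable := hC.stable
  dom x hx := hC.dom x (h hx)

theorem exists_four_cycle (hA : Good A) (hC : TightCover A H W) (hXH : X ⊆ H) (hX : StrongOn A X)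
    (hd : ¬ Dicol A X 2) {u x : V} (hu : u ∈ W) (hx : x ∈ X) (hux : Nb A u x) :
    ∃ p ∈ X, ∃ o ∈ X, ∃ m ∈ X, A u p ∧ A p o ∧ A o m ∧ A m u := by
  have hC' := hC.mono hXH
  rcases hux with h | h
  · exact OrientedColouring.exists_four_cycle hA hX hd (hC'.fwd u hu) hx h
  · obtain ⟨p, hp, o, ho, m, hm, h1, h2, h3, h4⟩ :=
      OrientedColouring.exists_four_cycle hA.flip hX.flip (fun h => hd h.of_flip)
        (fun z hz z' hz' z'' hz'' h1 h2 h3 => nb_flip.2 (hC'.bwd u hu z hz z' hz' z'' hz'' h1 h2 h3))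
        hx h
    exact ⟨m, hm, o, ho, p, hp, h4, h3, h2, h1⟩

theorem nb_of_nb_mid (hC : TightCover A H W) {u p o m y : V} (hu : u ∈ W) (hp : p ∈ H)
    (ho : o ∈ H) (hm : m ∈ H) (hy : y ∈ H) (hup : A u p) (hpo : A p o) (hom : A o m) (hmu : A m u)
    (h : Nb A o y) : Nb A u y :=
  h.elim (fun h => hC.fwd u hu p hp o ho y hy hup hpo h)
    (fun h => hC.bwd u hu m hm o ho y hy hmu hom h)

/-- A directed 4-cycle `u → p → o → w 0 → u` with a walk of length `d` in `H` from `w 0` to `X`,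
where `u` has no neighbour in `X`. -/
def Tail (A : V → V → Prop) (H W X : Set V) (d : ℕ) : Prop :=
  ∃ u ∈ W, (∀ h ∈ X, ¬ Nb A u h) ∧ ∃ p ∈ H, ∃ o ∈ H, ∃ w : ℕ → V, A u p ∧ A p o ∧ A o (w 0) ∧
    A (w 0) u ∧ (∀ i < d, A (w i) (w (i + 1))) ∧ (∀ i ≤ d, w i ∈ H) ∧ w d ∈ X

theorem exists_tail (hC : TightCover A H W) (hXH : X ⊆ H) (hs : ∀ x ∈ X, ∃ y ∈ X, A x y) :
    ∀ (n : ℕ) (u : V) (w : ℕ → V), u ∈ W → (∀ h ∈ X, ¬ Nb A u h) → A u (w 0) →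
      (∀ i < n, A (w i) (w (i + 1))) → (∀ i ≤ n, w i ∈ H) → w n ∈ X →
      ∃ d, d + 2 ≤ n ∧ Tail A H W X d := by
  intro n
  induction n using Nat.strong_induction_on with
  | _ n ih =>
    intro u w hu hux huw hst hwH hwX
    match n, ih, hst, hwH, hwX with
    | 0, _, _, _, hwX => exact absurd (.inl huw) (hux _ hwX)
    | 1, _, hst, hwH, hwX =>
      obtain ⟨y, hy, h⟩ := hs _ hwX
      exact absurd (hC.fwd u hu _ (hwH 0 zero_le_one) _ (hwH 1 le_rfl) y (hXH hy) huw
        (hst 0 one_pos) h) (hux y hy)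
    | n + 2, ih, hst, hwH, hwX =>
      have h01 := hst 0 (by omega)
      have h12 := hst 1 (by omega)
      have hst' : ∀ i < n, A (w (i + 2)) (w (i + 1 + 2)) := fun i hi => by
        have := hst (i + 2) (by omega)
        rwa [show i + 2 + 1 = i + 1 + 2 by omega] at this
      have hwH' : ∀ i ≤ n, w (i + 2) ∈ H := fun i hi => hwH _ (by omega)
      rcases hC.fwd u hu _ (hwH 0 (by omega)) _ (hwH 1 (by omega)) _ (hwH 2 (by omega))
        huw h01 h12 with h | h
      · obtain ⟨d, hd, ht⟩ := ih n (by omega) u (fun i => w (i + 2)) hu hux h hst' hwH' hwX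
        exact ⟨d, by omega, ht⟩
      · exact ⟨n, le_rfl, u, hu, hux, w 0, hwH 0 (by omega), w 1, hwH 1 (by omega),
          fun i => w (i + 2), huw, h01, h12, h, hst', hwH', hwX⟩

theorem exists_short_tail (hA : Good A) (hC : TightCover A H W) (hXH : X ⊆ H)
    (hH : StrongOn A H) (hX : StrongOn A X) (hdX : ¬ Dicol A X 2)
    {u₀ h₀ : V} (hu₀ : u₀ ∈ W) (hh₀ : h₀ ∈ H) (hu₀h₀ : A u₀ h₀) (hu₀X : ∀ h ∈ X, ¬ Nb A u₀ h) :
    Tail A H W X 1 := by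
  classical
  have hs : ∀ x ∈ X, ∃ y ∈ X, A x y := fun x hx => hX.exists_succ hA hdX hx
  obtain ⟨x₀, hx₀⟩ := nonempty_of_not_dicol hdX
  have hex : ∃ d, Tail A H W X d := by
    obtain ⟨n, w, h0, hn, hst, hwH⟩ := exists_walk (hH h₀ hh₀ x₀ (hXH hx₀)) hh₀
    obtain ⟨d, -, hd⟩ := hC.exists_tail hXH hs n u₀ w hu₀ hu₀X (h0 ▸ hu₀h₀) hst hwH (hn ▸ hx₀)
    exact ⟨d, hd⟩
  have hmin : ∀ d, Tail A H W X d → Nat.find hex ≤ d := fun d hd => Nat.find_min' hex hd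
  obtain ⟨u, hu, huX, p, hp, o, ho, w, hup, hpo, how, hwu, hst, hwH, hwX⟩ := Nat.find_spec hex
  generalize Nat.find hex = d at hst hwH hwX hmin
  by_contra hone
  have hd0 : d ≠ 0 := by
    rintro rfl
    exact huX _ hwX (.inr hwu)
  have hd1 : d ≠ 1 := by
    rintro rfl
    exact hone ⟨u, hu, huX, p, hp, o, ho, w, hup, hpo, how, hwu, hst, hwH, hwX⟩
  have hm := hwH 0 (Nat.zero_le _)
  have hmX : ∀ h ∈ X, ¬ Nb A (w 0) h := by
    rintro h hh (hmh | hmh)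
    · have := hmin 1 ⟨u, hu, huX, p, hp, o, ho, fun i => if i = 0 then w 0 else h, hup, hpo,
        how, hwu, fun i hi => by simpa [show i = 0 by omega] using hmh, fun i hi => by
          dsimp only; split_ifs
          exacts [hm, hXH hh], hh⟩
      omega
    · obtain ⟨h', hh', h1⟩ := hX.exists_pred hA hdX hh
      exact huX h' hh' (hC.bwd u hu _ hm h (hXH hh) h' (hXH hh') hwu hmh h1)
  have hoX : ∀ h ∈ X, ¬ Nb A o h := fun h hh hoh =>
    huX h hh (hC.nb_of_nb_mid hu hp ho hm (hXH hh) hup hpo how hwu hoh)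
  obtain ⟨v, hv, hvo⟩ := hC.dom o ho
  have hvX : ∀ h ∈ X, ¬ Nb A v h := by
    intro h hh hvh
    obtain ⟨-, -, y', hy', y, hy, -, -, h1, h2⟩ := hC.exists_four_cycle hA hXH hX hdX hv hh hvh
    exact hA.p6 y' y v o (w 0) u h1 h2 hvo how hwu
      (mt Nb.symm (hoX _ hy')) (mt Nb.symm (hmX _ hy')) (mt Nb.symm (huX _ hy'))
      (mt Nb.symm (hmX _ hy)) (mt Nb.symm (huX _ hy)) (hC.stable v hv u hu)
  obtain ⟨d', hd', ht⟩ := hC.exists_tail hXH hs (d + 1) v (fun i => Nat.casesOn i o w) hv hvX hvo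
    (by
      rintro (_ | i) hi
      exacts [how, hst i (by omega)])
    (by
      rintro (_ | i) hi
      exacts [ho, hwH i (by omega)]) hwX
  have := hmin d' ht
  omega

/-- A directed 4-cycle `u → p → o → y 0 → u` without neighbours in `X`, with a walk of length `n`
in `H` from `y 0` to `X` whose later vertices are not adjacent to `u`. -/
structure Lasso (A : V → V → Prop) (H W X : Set V) (n : ℕ) (u p o : V) (y : ℕ → V) : Prop where
  hu : u ∈ W
  hp : p ∈ H
  ho : o ∈ H
  hy : ∀ i ≤ n, y i ∈ H
  up : A u p
  po : A p o
  om : A o (y 0)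
  mu : A (y 0) u
  step : ∀ i < n, A (y i) (y (i + 1))
  uX : ∀ h ∈ X, ¬ Nb A u h
  pX : ∀ h ∈ X, ¬ Nb A p h
  oX : ∀ h ∈ X, ¬ Nb A o h
  mX : ∀ h ∈ X, ¬ Nb A (y 0) h
  uy : ∀ i, 1 ≤ i → i ≤ n → ¬ Nb A u (y i)
  mem : y n ∈ X

theorem Lasso.exists_shorter (hA : Good A) (hC : TightCover A H W) (hXH : X ⊆ H)
    (hX : StrongOn A X) (hdX : ¬ Dicol A X 2) {u p o : V} {y : ℕ → V}
    (L : Lasso A H W X n u p o y) :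
    ∃ n' < n, ∃ u p o y, Lasso A H W X n' u p o y := by
  by_contra! hmin
  have hs : ∀ x ∈ X, ∃ y ∈ X, A x y := fun x hx => hX.exists_succ hA hdX hx
  have hpr : ∀ x ∈ X, ∃ y ∈ X, A y x := fun x hx => hX.exists_pred hA hdX hx
  obtain ⟨hu, hp, ho, hy, up, po, om, mu, st, uX, pX, oX, mX, uy, mem⟩ := L
  have hm := hy 0 (Nat.zero_le _)
  have hn2 : 2 ≤ n := by
    by_contra hn
    obtain rfl | rfl : n = 0 ∨ n = 1 := by omega
    · exact uX _ mem (.inr mu)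
    · exact mX _ mem (.inl (st 0 one_pos))
  have oy : ∀ i, 1 ≤ i → i ≤ n → ¬ Nb A o (y i) := fun i h1 h2 h =>
    uy i h1 h2 (hC.nb_of_nb_mid hu hp ho hm (hy i h2) up po om mu h)
  have my : ∀ i, 2 ≤ i → i ≤ n → ¬ Nb A (y 0) (y i) := by
    rintro i h1 h2 (h | h)
    · refine hmin (n - i + 1) (by omega) u p o (fun j => if j = 0 then y 0 else y (i + j - 1))
        ⟨hu, hp, ho, ?_, up, po, om, mu, ?_, uX, pX, oX, mX, ?_, ?_⟩
      · intro j hj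
        split_ifs
        exacts [hm, hy _ (by omega)]
      · rintro (_ | j) hj
        · simpa using h
        · have := st (i + j) (by omega)
          simpa [show i + (j + 1) - 1 = i + j by omega,
            show i + (j + 1 + 1) - 1 = i + j + 1 by omega] using this
      · intro j h3 h4
        simp only [show j ≠ 0 by omega, if_false]
        exact uy _ (by omega) (by omega)
      · simpa [show i + (n - i + 1) - 1 = n by omega] using mem
    · have h3 := st (i - 1) (by omega)
      rw [show i - 1 + 1 = i by omega] at h3
      exact uy (i - 1) (by omega) (by omega)
        (hC.bwd u hu _ hm _ (hy i h2) _ (hy (i - 1) (by omega)) mu h h3)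
  have key : ∀ v ∈ W, ∀ h ∈ X, Nb A v h → ¬ Nb A v o := by
    rintro v hv h hh hvh hvo
    obtain ⟨p', hp', o', ho', m', hm', h1, h2, h3, h4⟩ :=
      hC.exists_four_cycle hA hXH hX hdX hv hh hvh
    rcases hvo with hvo | hvo
    · exact hA.p6 o' m' v o (y 0) u h3 h4 hvo om mu (mt Nb.symm (oX _ ho'))
        (mt Nb.symm (mX _ ho')) (mt Nb.symm (uX _ ho')) (mt Nb.symm (mX _ hm'))
        (mt Nb.symm (uX _ hm')) (hC.stable v hv u hu)
    · exact hA.p6 u p o v p' o' up po hvo h1 h2 (hC.stable u hu v hv) (uX _ hp') (uX _ ho')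
        (pX _ hp') (pX _ ho') (oX _ ho')
  have hy01 : A (y 0) (y 1) := st 0 (by omega)
  have hy12 : A (y 1) (y 2) := st 1 (by omega)
  have hy1 := hy 1 (by omega)
  have hy2 := hy 2 (by omega)
  by_cases hn : n = 2
  · subst hn
    obtain ⟨h', hh', hs'⟩ := hs _ mem
    have hpy : Nb A p (y 1) := by
      by_contra hpy
      exact hA.p6 p o (y 0) (y 1) (y 2) h' po om hy01 hy12 hs' hpy (pX _ mem) (pX _ hh')
        (oX _ mem) (oX _ hh') (mX _ hh')
    rcases hpy with hpy | hpy
    · exact uX _ mem (hC.fwd u hu p hp _ hy1 _ hy2 up hpy hy12)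
    · obtain ⟨v, hv, hvy⟩ := hC.dom _ hy1
      exact key v hv h' hh' (hC.fwd v hv _ hy1 _ hy2 _ (hXH hh') hvy hy12 hs')
        (hC.fwd v hv _ hy1 _ hp _ ho hvy hpy po)
  obtain ⟨v, hv, hvo⟩ := hC.dom o ho
  have vX : ∀ h ∈ X, ¬ Nb A v h := fun h hh hvh => key v hv h hh hvh (.inl hvo)
  have back : ∀ i, 3 ≤ i → i ≤ n → ¬ A (y i) v := by
    intro i h1 h2 h
    have h3 := st (i - 1) (by omega)
    rw [show i - 1 + 1 = i by omega] at h3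
    exact hA.p6 (y (i - 1)) (y i) v o (y 0) u h3 h hvo om mu
      (mt Nb.symm (oy _ (by omega) (by omega))) (mt Nb.symm (my _ (by omega) (by omega)))
      (mt Nb.symm (uy _ (by omega) (by omega))) (mt Nb.symm (my _ (by omega) (by omega)))
      (mt Nb.symm (uy _ (by omega) (by omega))) (hC.stable v hv u hu)
  have forth : ∀ j i, i + j = n → 1 ≤ i → ¬ A v (y i) := by
    intro j
    induction j using Nat.strong_induction_on with
    | _ j ih =>
      intro i hij h1 h
      match j, ih, hij with
      | 0, _, hij =>
        obtain rfl : i = n := by omega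
        exact vX _ mem (.inl h)
      | 1, _, hij =>
        subst hij
        obtain ⟨h', hh', hs'⟩ := hs _ mem
        exact vX h' hh' (hC.fwd v hv _ (hy i (by omega)) _ (hy (i + 1) le_rfl) _ (hXH hh') h
          (st i (by omega)) hs')
      | j + 2, ih, hij =>
        rcases hC.fwd v hv _ (hy i (by omega)) _ (hy (i + 1) (by omega)) _
          (hy (i + 2) (by omega)) h (st i (by omega)) (st (i + 1) (by omega)) with h' | h'
        · exact ih j (by omega) (i + 2) (by omega) (by omega) h'
        · exact back (i + 2) (by omega) (by omega) h'
  have hvy1 : A (y 1) v := (hC.fwd v hv o ho _ hm _ hy1 hvo om hy01).resolve_left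
    (forth (n - 1) 1 (by omega) le_rfl)
  refine hmin (n - 1) (by omega) v o (y 0) (fun j => y (j + 1)) ⟨hv, ho, hm, ?_, hvo, om, hy01,
    hvy1, ?_, vX, oX, mX, ?_, ?_, ?_⟩
  · exact fun i hi => hy _ (by omega)
  · exact fun i hi => st _ (by omega)
  · rintro h hh (h1 | h1)
    · refine hmin 2 (by omega) u p o (fun j => if j = 2 then h else y j)
        ⟨hu, hp, ho, ?_, up, po, om, mu, ?_, uX, pX, oX, mX, ?_, hh⟩
      · intro i hi
        split_ifs
        exacts [hXH hh, hy _ (by omega)]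
      · intro i hi
        obtain rfl | rfl : i = 0 ∨ i = 1 := by omega
        exacts [hy01, h1]
      · intro i hi hi'
        obtain rfl | rfl : i = 1 ∨ i = 2 := by omega
        exacts [uy 1 le_rfl (by omega), uX h hh]
    · obtain ⟨h', hh', h2⟩ := hpr h hh
      exact vX h' hh' (hC.bwd v hv _ hy1 _ (hXH hh) _ (hXH hh') hvy1 h1 h2)
  · rintro i h1 h2 (h | h)
    · exact forth (n - (i + 1)) (i + 1) (by omega) (by omega) h
    · obtain rfl | hi : i = 1 ∨ 2 ≤ i := by omega
      · exact hA.tri _ _ _ (.inl hy12) (.inl h) (.inl hvy1)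
      · exact back (i + 1) (by omega) (by omega) h
  · simpa [show n - 1 + 1 = n by omega] using mem

theorem not_lasso (hA : Good A) (hC : TightCover A H W) (hXH : X ⊆ H)
    (hX : StrongOn A X) (hdX : ¬ Dicol A X 2) :
    ∀ (n : ℕ) (u p o : V) (y : ℕ → V), ¬ Lasso A H W X n u p o y := by
  intro n
  induction n using Nat.strong_induction_on with
  | _ n ih =>
    intro u p o y L
    obtain ⟨n', hn', u', p', o', y', L'⟩ := Lasso.exists_shorter hA hC hXH hX hdX L
    exact ih n' hn' u' p' o' y' L'

theorem dicol [Finite V] (hA : Good A) (hC : TightCover A H W) : Dicol A H 5 := by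
  by_contra hH
  obtain ⟨M, hMH, hM, hdM⟩ := exists_strongOn hH
  replace hC := hC.mono hMH
  obtain ⟨h₀, hh₀⟩ := nonempty_of_not_dicol hdM
  obtain ⟨u₀, hu₀, h01⟩ := hC.dom h₀ hh₀
  obtain ⟨H₂, hH₂, hs₂, hd₂⟩ := exists_strongOn (not_dicol_sdiff_nbhd hA u₀ hdM)
  have hH₂M : H₂ ⊆ M := fun x hx => (hH₂ hx).1
  obtain ⟨u, hu, huX, p, hp, o, ho, w, hup, hpo, how, hwu, hst, hwH, hwX⟩ :=
    hC.exists_short_tail hA hH₂M hM hs₂ (fun h => hd₂ (h.mono subset_rfl (by norm_num)))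
      hu₀ hh₀ h01 fun h hh => (hH₂ hh).2
  have hm := hwH 0 (Nat.zero_le _)
  obtain ⟨H₃, hH₃, hs₃, hd₃⟩ := exists_strongOn
    (not_dicol_sdiff_nbhd hA (w 0) (not_dicol_sdiff_nbhd hA p hd₂))
  have hH₃₂ : H₃ ⊆ H₂ := fun x hx => (hH₃ hx).1.1
  obtain ⟨x, hx⟩ := nonempty_of_not_dicol hd₃
  obtain ⟨n, y, h0, hn, hys, hyH⟩ := exists_walk (hs₂ _ hwX x (hH₃₂ hx)) hwX
  refine hC.not_lasso hA (hH₃₂.trans hH₂M) hs₃ hd₃ (n + 1) u p o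
    (fun i => Nat.casesOn i (w 0) y) ⟨hu, hp, ho, ?_, hup, hpo, how, hwu, ?_, ?_, ?_, ?_, ?_, ?_, ?_⟩
  · rintro (_ | i) hi
    exacts [hm, hH₂M (hyH i (by omega))]
  · rintro (_ | i) hi
    · have := hst 0 one_pos
      simpa [h0] using this
    · exact hys i (by omega)
  · exact fun h hh => huX h (hH₃₂ hh)
  · exact fun h hh => (hH₃ hh).1.2
  · exact fun h hh hoh => huX h (hH₃₂ hh)
      (hC.nb_of_nb_mid hu hp ho hm (hH₂M (hH₃₂ hh)) hup hpo how hwu hoh)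
  · exact fun h hh => (hH₃ hh).2
  · rintro (_ | i) h1 h2
    · omega
    · exact huX _ (hyH i (by omega))
  · simpa [hn] using hx

end TightCover

/-- A set dominated by common in-neighbours `W` of `s` and out-neighbours of `k` is
5-dicolourable when `k` and `s` extend to directed walks avoiding its neighbourhood. -/
theorem dicol_of_dominated [Finite V] (hA : Good A) {H W : Set V} {k k' s s' : V}
    (hk : A k' k) (hs : A s s') (hW : ∀ u ∈ W, A k u ∧ A u s)
    (hkH : ∀ h ∈ H, ¬ Nb A k h) (hk'H : ∀ h ∈ H, ¬ Nb A k' h)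
    (hsH : ∀ h ∈ H, ¬ Nb A s h) (hs'H : ∀ h ∈ H, ¬ Nb A s' h)
    (hdom : ∀ h ∈ H, ∃ u ∈ W, A u h) : Dicol A H 5 :=
  TightCover.dicol (W := W) hA
    { fwd := fun u hu => InRoot.tight hA ⟨(hW u hu).1, hk, hkH, hk'H⟩
      bwd := fun u hu => OutRoot.tight hA (OutRoot.mk' (hW u hu).2 hs hsH hs'H)
      stable := fun u hu w hw =>
        hA.not_nb_of_nb_nb (.inr (hW u hu).1) (.inl (hW w hw).1)
      dom := hdom }

/-- A directed walk `a → b → c` entering `T` only through `c`, with one of two kinds of escapes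
avoiding the neighbourhood of `T`. -/
structure Frame (A : V → V → Prop) (T : Set V) (a b c : V) : Prop where
  ab : A a b
  bc : A b c
  aT : ∀ t ∈ T, ¬ A a t
  bT : ∀ t ∈ T, ¬ A b t
  cT : ∃ t ∈ T, A c t
  escape : (∃ k k₁, A c k ∧ A k k₁ ∧ (∀ t ∈ T, ¬ Nb A k t) ∧ ∀ t ∈ T, ¬ Nb A k₁ t) ∨
    ((∀ t ∈ T, ¬ Nb A b t) ∧ (∃ k, A b k ∧ ∀ t ∈ T, ¬ Nb A k t) ∧ ∀ t ∈ T, ¬ A t c)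

/-- In the presence of a frame, the neighbourhood of `T` can be coloured with no extra colours. -/
theorem Frame.dicol [Finite V] (hA : Good A) {a b c : V} (hF : Frame A T a b c)
    (hd : Dicol A {x | x ∈ T ∧ ¬ Nb A a x ∧ ¬ Nb A b x ∧ ¬ Nb A c x} 28) : Dicol A T 28 := by
  obtain ⟨ab, bc, aT, bT, -, esc⟩ := hF
  set U : Set V := {x | x ∈ T ∧ ¬ Nb A a x ∧ ¬ Nb A b x ∧ ¬ Nb A c x} with hU
  set W : Set V := {x | x ∈ T ∧ A c x ∧ A x a} with hW
  set D₁ : Set V := {x | x ∈ U ∧ ∃ w ∈ W, A w x} with hD₁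
  set D₂ : Set V := {x | x ∈ U ∧ ∃ w ∈ W, A x w} with hD₂
  set R : Set V := {x | x ∈ U ∧ x ∉ D₁ ∧ x ∉ D₂} with hR
  set R' : Set V := {x | x ∈ R ∧ (∃ y ∈ R, A x y) ∧ ∃ y ∈ R, A y x} with hR'
  have hd₁ : Dicol A D₁ 5 := dicol_of_dominated (W := W) hA bc ab (fun u hu => hu.2)
    (fun h hh => hh.1.2.2.2) (fun h hh => hh.1.2.2.1) (fun h hh => hh.1.2.1)
    (fun h hh => hh.1.2.2.1) fun h hh => hh.2
  have hd₂ : Dicol A D₂ 5 := Dicol.of_flip <| dicol_of_dominated (A := flip A) (W := W)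
    (k := a) (k' := b) (s := c) (s' := b) hA.flip ab bc (fun u hu => ⟨hu.2.2, hu.2.1⟩)
    (fun h hh => nb_flip.not.2 hh.1.2.1) (fun h hh => nb_flip.not.2 hh.1.2.2.1)
    (fun h hh => nb_flip.not.2 hh.1.2.2.2) (fun h hh => nb_flip.not.2 hh.1.2.2.1) fun h hh => hh.2
  have hS : Dicol A (T \ R) 13 := by
    refine ((((dicol_nbhd hA a T).union (dicol_nbhd hA b T)).union
      (dicol_nbhd hA c T)).union (hd₁.union hd₂)).subset fun x hx => ?_
    by_cases hxU : x ∈ U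
    · refine .inr ?_
      by_contra h
      exact hx.2 ⟨hxU, fun h' => h (.inl h'), fun h' => h (.inr h')⟩
    · refine .inl ?_
      by_contra h
      exact hxU ⟨hx.1, fun h' => h (.inl (.inl ⟨hx.1, h'⟩)),
        fun h' => h (.inl (.inr ⟨hx.1, h'⟩)), fun h' => h (.inr ⟨hx.1, h'⟩)⟩
  have hZ₁ : Dicol A {x | x ∈ R ∧ ∀ y ∈ R, ¬ A x y} 1 :=
    dicol_one_of_stable fun x hx y hy => hx.2 y hy.1
  have hZ₂ : Dicol A {x | x ∈ R ∧ ∀ y ∈ R, ¬ A y x} 1 :=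
    dicol_one_of_stable fun x hx y hy => hy.2 x hx.1
  have hsub : ∀ x ∈ T \ R, (∀ z ∈ R', ¬ A x z) ∨ ∀ y ∈ R', ¬ A y x := by
    rintro x hx
    by_contra! h
    obtain ⟨⟨z, hz, hxz⟩, y, hy, hyx⟩ := h
    obtain ⟨hz, ⟨z', hz', hzz'⟩, -⟩ := hz
    obtain ⟨hy, -, y', hy', hyy'⟩ := hy
    have hcx : ¬ A c x := by
      intro hcx
      have hax : Nb A a x := by
        by_contra hax
        exact hA.p6 a b c x z z' ab bc hcx hxz hzz' hax hz.1.2.1 hz'.1.2.1 hz.1.2.2.1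
          hz'.1.2.2.1 hz'.1.2.2.2
      exact hz.2.1 ⟨hz.1, x, ⟨hx.1, hcx, hax.resolve_left (aT x hx.1)⟩, hxz⟩
    have hxc : ¬ A x c := by
      intro hxc
      rcases esc with ⟨k, k₁, h1, h2, hk, hk₁⟩ | ⟨-, -, h⟩
      · exact hA.p6 y' y x c k k₁ hyy' hyx hxc h1 h2 (mt Nb.symm hy'.1.2.2.2)
          (mt Nb.symm (hk _ hy'.1.1)) (mt Nb.symm (hk₁ _ hy'.1.1)) (mt Nb.symm (hk _ hy.1.1))
          (mt Nb.symm (hk₁ _ hy.1.1)) (mt Nb.symm (hk₁ _ hx.1))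
      · exact h x hx.1 hxc
    have hnc : ¬ Nb A c x := not_or.2 ⟨hcx, hxc⟩
    have hnb : ¬ Nb A b x := by
      rintro (h | hxb)
      · exact bT x hx.1 h
      · rcases esc with ⟨k, k₁, h1, h2, hk, hk₁⟩ | ⟨h, -, -⟩
        · exact hA.p6 y' y x b c k hyy' hyx hxb bc h1 (mt Nb.symm hy'.1.2.2.1)
            (mt Nb.symm hy'.1.2.2.2) (mt Nb.symm (hk _ hy'.1.1)) (mt Nb.symm hy.1.2.2.2)
            (mt Nb.symm (hk _ hy.1.1)) (mt Nb.symm (hk _ hx.1))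
        · exact h x hx.1 (.inr hxb)
    have hna : ¬ Nb A a x := by
      rintro (h | hxa)
      · exact aT x hx.1 h
      · rcases esc with - | ⟨-, ⟨k, h1, hk⟩, -⟩
        · exact hA.p6 y' y x a b c hyy' hyx hxa ab bc (mt Nb.symm hy'.1.2.1)
            (mt Nb.symm hy'.1.2.2.1) (mt Nb.symm hy'.1.2.2.2) (mt Nb.symm hy.1.2.2.1)
            (mt Nb.symm hy.1.2.2.2) (mt Nb.symm hnc)
        · exact hA.p6 y' y x a b k hyy' hyx hxa ab h1 (mt Nb.symm hy'.1.2.1)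
            (mt Nb.symm hy'.1.2.2.1) (mt Nb.symm (hk _ hy'.1.1)) (mt Nb.symm hy.1.2.2.1)
            (mt Nb.symm (hk _ hy.1.1)) (mt Nb.symm (hk _ hx.1))
    have hxU : x ∈ U := ⟨hx.1, hna, hnb, hnc⟩
    have hRW : ∀ r ∈ R, ∀ w ∈ W, ¬ Nb A w r := by
      rintro r hr w hw (h | h)
      · exact hr.2.1 ⟨hr.1, w, hw, h⟩
      · exact hr.2.2 ⟨hr.1, w, hw, h⟩
    by_cases hx₁ : x ∈ D₁
    · obtain ⟨w, hw, hwx⟩ := hx₁.2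
      exact hA.p6 b c w x z z' bc hw.2.1 hwx hxz hzz' hnb hz.1.2.2.1 hz'.1.2.2.1 hz.1.2.2.2
        hz'.1.2.2.2 (hRW z' hz' w hw)
    by_cases hx₂ : x ∈ D₂
    · obtain ⟨w, hw, hxw⟩ := hx₂.2
      exact hA.p6 y' y x w a b hyy' hyx hxw hw.2.2 ab (mt Nb.symm (hRW y' hy' w hw))
        (mt Nb.symm hy'.1.2.1) (mt Nb.symm hy'.1.2.2.1) (mt Nb.symm hy.1.2.1)
        (mt Nb.symm hy.1.2.2.1) (mt Nb.symm hnb)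
    exact hx.2 ⟨hxU, hx₁, hx₂⟩
  refine Dicol.of_dipolar (n := 14) (R := R')
    (P := {x | x ∈ T \ R ∧ ∀ z ∈ R', ¬ A x z} ∪ {x | x ∈ R ∧ ∀ y ∈ R, ¬ A x y})
    (Q := {x | x ∈ T \ R ∧ ∀ y ∈ R', ¬ A y x} ∪ {x | x ∈ R ∧ ∀ y ∈ R, ¬ A y x})
    ((hS.subset fun x hx => hx.1).union hZ₁) ((hS.subset fun x hx => hx.1).union hZ₂)
    (hd.subset fun x hx => hx.1.1) ?_ ?_ fun x hx => ?_
  · rintro x (hx | hx) y hy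
    exacts [hx.2 y hy, hx.2 y hy.1]
  · rintro x hx y (hy | hy)
    exacts [hy.2 x hx, hy.2 x hx.1]
  · by_cases hxR : x ∈ R
    · by_cases h1 : ∃ y ∈ R, A x y
      · by_cases h2 : ∃ y ∈ R, A y x
        · exact .inr ⟨hxR, h1, h2⟩
        · push Not at h2
          exact .inl (.inr (.inr ⟨hxR, h2⟩))
      · push Not at h1
        exact .inl (.inl (.inr ⟨hxR, h1⟩))
    · rcases hsub x ⟨hx, hxR⟩ with h | h
      · exact .inl (.inl (.inl ⟨⟨hx, hxR⟩, h⟩))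
      · exact .inl (.inr (.inl ⟨⟨hx, hxR⟩, h⟩))

/-- The vertices of `G` without neighbours in `K`. -/
def Far (A : V → V → Prop) (K G : Set V) : Set V := {x | x ∈ G ∧ ∀ κ ∈ K, ¬ Nb A κ x}

/-- A walk `v 0 → v 1 → ⋯ → v m` that starts with two vertices of `K`, continues in `G` and can be
prolonged by a vertex of `T`. -/
structure Approach (A : V → V → Prop) (K G T : Set V) (m : ℕ) (v : ℕ → V) : Prop where
  zero : v 0 ∈ K
  one : v 1 ∈ K
  le : 2 ≤ m
  step : ∀ i < m, A (v i) (v (i + 1))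
  mem : ∀ i, 2 ≤ i → i ≤ m → v i ∈ G
  last : ∃ h ∈ T, A (v m) h

/-- Let `T` be a strong component, not 2-dicolourable, of the vertices of `G` far from `K`. If `K`
is suitably closed and `T` can be reached from `K` through `G`, then `T` has a frame, or there is
a directed 4-cycle that meets `T` and has a vertex `u` dominated by `K`. -/
theorem exists_frame_or_cycle (hA : Good A) {K G : Set V} (hT : IsComp A (Far A K G) T)
    (hd : ¬ Dicol A T 2)
    (hpred : ∀ κ ∈ K, ∀ u ∈ G, A κ u → ∃ κ₀ ∈ K, A κ₀ κ)
    (hsucc : ∀ κ ∈ K, ∀ u ∈ G, A u κ → ∃ κ₁, A κ κ₁ ∧ ∀ t ∈ T, ¬ Nb A κ₁ t)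
    (hreach : ∃ κ ∈ K, ∃ g ∈ G, A κ g ∧ ∃ t ∈ T, ReflTransGen (On A G) g t) :
    (∃ a b c, Frame A T a b c) ∨
      ∃ u ∈ G, (∀ κ ∈ K, ¬ A u κ) ∧ (∃ z ∈ Far A K G, ∃ z' ∈ Far A K G, A u z ∧ A z z') ∧
        (∃ κ₀ ∈ K, ∃ κ ∈ K, A κ₀ κ ∧ A κ u) ∧
        ∃ q₁ q₂, ∃ q₃ ∈ T, A u q₁ ∧ A q₁ q₂ ∧ A q₂ q₃ ∧ A q₃ u := by
  classical
  have hKT : ∀ κ ∈ K, ∀ t ∈ T, ¬ Nb A κ t := fun κ hκ t ht => (hT.subset ht).2 κ hκ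
  have hex : ∃ m v, Approach A K G T m v := by
    obtain ⟨κ, hκ, g, hg, hκg, t, ht, hgt⟩ := hreach
    obtain ⟨κ₀, hκ₀, h0⟩ := hpred κ hκ g hg hκg
    obtain ⟨n, w, hw0, hwn, hst, hwG⟩ := exists_walk hgt hg
    have hn : n ≠ 0 := by
      rintro rfl
      exact hKT κ hκ t ht (.inl (by rwa [← hwn, hw0]))
    obtain ⟨n, rfl⟩ := Nat.exists_eq_succ_of_ne_zero hn
    refine ⟨n + 2, fun i => if i = 0 then κ₀ else if i = 1 then κ else w (i - 2),
      by simpa using hκ₀, by simpa using hκ, by omega, ?_, ?_, t, ht, ?_⟩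
    · rintro (_ | _ | i) hi
      · simpa using h0
      · simpa [hw0] using hκg
      · simpa using hst i (by omega)
    · rintro (_ | _ | i) h1 hi
      · omega
      · omega
      · simpa using hwG i (by omega)
    · have := hst n (by omega)
      rw [hwn] at this
      simpa using this
  obtain ⟨v, hv⟩ := Nat.find_spec hex
  have hmin : ∀ m' v, Approach A K G T m' v → Nat.find hex ≤ m' :=
    fun m' v h => Nat.find_min' hex ⟨v, h⟩
  generalize Nat.find hex = m at hv hmin
  obtain ⟨v0, v1, hm, hst, hvG, h, hh, hvh⟩ := hv
  have notIn : ∀ i, 3 ≤ i → i ≤ m → ∀ κ ∈ K, ¬ A κ (v i) := by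
    intro i h1 h2 κ hκ hκi
    obtain ⟨κ₀, hκ₀, h0⟩ := hpred κ hκ _ (hvG i (by omega) h2) hκi
    have := hmin (m - i + 2)
      (fun j => if j = 0 then κ₀ else if j = 1 then κ else v (i + (j - 2)))
      ⟨by simpa using hκ₀, by simpa using hκ, by omega, by
        rintro (_ | _ | j) hj
        · simpa using h0
        · simpa using hκi
        · simpa [add_assoc] using hst (i + j) (by omega), by
        rintro (_ | _ | j) h1 hj
        · omega
        · omega
        · simpa using hvG (i + j) (by omega) (by omega),
        h, hh, by simpa [show i + (m - i) = m by omega] using hvh⟩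
    omega
  have noOut : ∀ i < m, ∀ t ∈ T, ¬ A (v i) t := by
    intro i hi t ht hit
    obtain rfl | rfl | h2 : i = 0 ∨ i = 1 ∨ 2 ≤ i := by omega
    · exact hKT _ v0 t ht (.inl hit)
    · exact hKT _ v1 t ht (.inl hit)
    · have := hmin i v ⟨v0, v1, h2, fun j hj => hst j (by omega),
        fun j h1 hj => hvG j h1 (by omega), t, ht, hit⟩
      omega
  have notT : ∀ i, 2 ≤ i → i ≤ m → v i ∉ T := by
    intro i h1 h2 hi
    have := hst (i - 1) (by omega)
    rw [show i - 1 + 1 = i by omega] at this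
    exact noOut (i - 1) (by omega) _ hi this
  set P : ℕ → Prop := fun i => ∃ κ ∈ K, Nb A κ (v i) with hP
  have hP2 : P 2 := ⟨_, v1, .inl (hst 1 (by omega))⟩
  obtain ⟨J, hJ2, hJm, hPJ, hJ⟩ : ∃ J, 2 ≤ J ∧ J ≤ m ∧ P J ∧ ∀ i, J < i → i ≤ m → ¬ P i :=
    ⟨Nat.findGreatest P m, Nat.le_findGreatest hm hP2, Nat.findGreatest_le m,
      Nat.findGreatest_spec hm hP2, fun i => Nat.findGreatest_is_greatest⟩
  have far : ∀ i, J < i → i ≤ m → v i ∈ Far A K G := fun i h1 h2 =>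
    ⟨hvG i (by omega) h2, fun κ hκ hn => hJ i h1 h2 ⟨κ, hκ, hn⟩⟩
  have reach : ∀ j i, i + j = m → J < i → ReflTransGen (On A (Far A K G)) (v i) h := by
    intro j
    induction j with
    | zero =>
      rintro i rfl hi
      exact .single ⟨far _ hi le_rfl, hT.subset hh, hvh⟩
    | succ j ih =>
      intro i hij hi
      exact (ih (i + 1) (by omega) (by omega)).head
        ⟨far _ hi (by omega), far _ (by omega) (by omega), hst i (by omega)⟩
  have noIn : ∀ i, J < i → i ≤ m → ∀ t ∈ T, ¬ A t (v i) := fun i h1 h2 t ht hti =>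
    notT i (by omega) h2 (hT.closed _ (far i h1 h2) ⟨t, ht, hti⟩
      ⟨h, hh, reach (m - i) i (by omega) h1⟩)
  have sep : ∀ i, J < i → i < m → ∀ t ∈ T, ¬ Nb A (v i) t := fun i h1 h2 t ht hn =>
    hn.elim (noOut i h2 t ht) (noIn i h1 h2.le t ht)
  have hs1 := hst (m - 1) (by omega)
  have hs2 := hst (m - 2) (by omega)
  rw [show m - 1 + 1 = m by omega] at hs1
  rw [show m - 2 + 1 = m - 1 by omega] at hs2
  have contra : J < m → (∀ t ∈ T, ¬ Nb A (v (m - 1)) t) → (∀ t ∈ T, ¬ Nb A (v (m - 2)) t) →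
      False := by
    intro h1 h2 h3
    obtain ⟨-, -, -, -, q, hq, -, -, -, h4⟩ := InRoot.exists_four_cycle hA
      (⟨hs1, hs2, h2, h3⟩ : InRoot A T (v m) (v (m - 1)) (v (m - 2))) hT.strong hd hh hvh
    exact noIn m h1 le_rfl q hq h4
  by_cases hout : ∃ κ ∈ K, A (v J) κ
  · left
    obtain ⟨κ, hκ, hJκ⟩ := hout
    obtain ⟨κ₁, h1, h2⟩ := hsucc κ hκ _ (hvG J hJ2 hJm) hJκ
    rcases hJm.eq_or_lt with rfl | hJm
    · exact ⟨v (J - 2), v (J - 1), v J, hs2, hs1, noOut _ (by omega), noOut _ (by omega),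
        ⟨h, hh, hvh⟩, .inl ⟨κ, κ₁, hJκ, h1, hKT κ hκ, h2⟩⟩
    have sepJ : ∀ t ∈ T, ¬ Nb A (v J) t := by
      rintro t ht (hn | hn)
      · exact noOut J hJm t ht hn
      · obtain ⟨p, hp, -, -, -, -, h3, -⟩ := OutRoot.exists_four_cycle hA
          (OutRoot.mk' hJκ h1 (hKT κ hκ) h2) hT.strong hd ht hn
        exact noOut J hJm p hp h3
    obtain rfl | hJm' : m = J + 1 ∨ J + 2 ≤ m := by omega
    · exact ⟨v (J - 1), v J, v (J + 1), hs2, hs1, noOut _ (by omega), noOut _ (by omega),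
        ⟨h, hh, hvh⟩, .inr ⟨sepJ, ⟨κ, hJκ, hKT κ hκ⟩, noIn _ (by omega) le_rfl⟩⟩
    · refine (contra hJm (sep _ (by omega) (by omega)) ?_).elim
      rcases hJm'.eq_or_lt with rfl | hlt
      · simpa using sepJ
      · exact sep _ (by omega) (by omega)
  · right
    push Not at hout
    obtain rfl : J = 2 := by
      obtain ⟨κ, hκ, hn⟩ := hPJ
      by_contra hne
      exact notIn J (by omega) hJm κ hκ (hn.resolve_right (hout κ hκ))
    have h01 := hst 0 (by omega)
    have h12 := hst 1 (by omega)
    refine ⟨v 2, hvG 2 le_rfl hm, hout, ?_⟩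
    obtain rfl | rfl | rfl | h5 : m = 2 ∨ m = 3 ∨ m = 4 ∨ 5 ≤ m := by omega
    · obtain ⟨p, hp, o, ho, q, hq, h1, h2, h3, h4⟩ := InRoot.exists_four_cycle hA
        (⟨hs1, hs2, hKT _ v1, hKT _ v0⟩ : InRoot A T (v 2) (v 1) (v 0)) hT.strong hd hh hvh
      exact ⟨⟨p, hT.subset hp, o, hT.subset ho, h1, h2⟩, ⟨_, v0, _, v1, h01, h12⟩,
        p, o, q, hq, h1, h2, h3, h4⟩
    · have h23 := hst 2 (by omega)
      have f3 := far 3 (by omega) le_rfl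
      obtain ⟨h', hh', hhh⟩ := hT.strong.exists_succ hA hd hh
      have hn : Nb A (v 2) h' := by
        by_contra hn
        exact hA.p6 _ _ _ _ _ _ h01 h12 h23 hvh hhh (f3.2 _ v0) (hKT _ v0 _ hh)
          (hKT _ v0 _ hh') (hKT _ v1 _ hh) (hKT _ v1 _ hh') hn
      exact ⟨⟨v 3, f3, h, hT.subset hh, h23, hvh⟩, ⟨_, v0, _, v1, h01, h12⟩, v 3, h, h', hh',
        h23, hvh, hhh, hn.resolve_left (noOut 2 (by omega) h' hh')⟩
    · have h23 := hst 2 (by omega)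
      have h34 := hst 3 (by omega)
      have f3 := far 3 (by omega) (by omega)
      have f4 := far 4 (by omega) le_rfl
      have hn : Nb A (v 2) h := by
        by_contra hn
        exact hA.p6 _ _ _ _ _ _ h01 h12 h23 h34 hvh (f3.2 _ v0) (f4.2 _ v0) (hKT _ v0 _ hh)
          (f4.2 _ v1) (hKT _ v1 _ hh) hn
      exact ⟨⟨v 3, f3, v 4, f4, h23, h34⟩, ⟨_, v0, _, v1, h01, h12⟩, v 3, v 4, h, hh,
        h23, h34, hvh, hn.resolve_left (noOut 2 (by omega) h hh)⟩
    · exact (contra (by omega) (sep _ (by omega) (by omega)) (sep _ (by omega) (by omega))).elim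

theorem Frame.dicol_of_strongOn [Finite V] (hA : Good A) {T : Set V} {a b c : V}
    (hT : StrongOn A T) (hF : Frame A T a b c) : Dicol A T 28 := by
  induction hN : T.ncard using Nat.strong_induction_on generalizing T a b c with
  | _ N ih =>
    by_contra hd
    obtain ⟨ab, bc, aT, bT, ⟨t, ht, hct⟩, esc⟩ := id hF
    set K : Set V := {a, b, c} with hK
    have hdR : ¬ Dicol A (Far A K T) 28 := fun h =>
      hd (hF.dicol hA (h.subset fun x hx => ⟨hx.1, by
        rintro κ (rfl | rfl | rfl)
        exacts [hx.2.1, hx.2.2.1, hx.2.2.2]⟩))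
    obtain ⟨T', hT', hd'⟩ := exists_isComp hdR
    have ha : a ∈ K := .inl rfl
    have hb : b ∈ K := .inr (.inl rfl)
    have hc : c ∈ K := .inr (.inr rfl)
    have hT'T : T' ⊆ T := fun x hx => (hT'.subset hx).1
    have hKT : ∀ κ ∈ K, ∀ t ∈ T', ¬ Nb A κ t := fun κ hκ t ht => (hT'.subset ht).2 κ hκ
    obtain ⟨t', ht'⟩ := nonempty_of_not_dicol hd'
    rcases exists_frame_or_cycle hA hT' (fun h => hd' (h.mono subset_rfl (by norm_num)))
      (by
        rintro κ (rfl | rfl | rfl) u hu h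
        exacts [absurd h (aT u hu), absurd h (bT u hu), ⟨b, hb, bc⟩])
      (by
        rintro κ (rfl | rfl | rfl) u hu h
        · exact ⟨b, ab, hKT b hb⟩
        · exact ⟨c, bc, hKT c hc⟩
        · rcases esc with ⟨k, -, h1, -, h2, -⟩ | ⟨-, -, h1⟩
          · exact ⟨k, h1, fun t ht => h2 t (hT'T ht)⟩
          · exact absurd h (h1 u hu))
      ⟨c, hc, t, ht, hct, t', ht', hT t ht t' (hT'T ht')⟩ with
      ⟨a', b', c', hF'⟩ | ⟨u, hu, huK, ⟨z, hz, z', hz', huz, hzz'⟩, ⟨-, -, κ, hκ, -, hκu⟩, -⟩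
    · refine hd' (ih T'.ncard ?_ hT'.strong hF' rfl)
      rw [← hN]
      refine Set.ncard_lt_ncard ⟨hT'T, fun h => hKT c hc t (h ht) (.inl hct)⟩
    · obtain rfl : κ = c := by
        rcases hκ with rfl | rfl | rfl
        exacts [absurd hκu (aT u hu), absurd hκu (bT u hu), rfl]
      exact hA.p6 a b κ u z z' ab bc hκu huz hzz' (not_or.2 ⟨aT u hu, huK a ha⟩) (hz.2 a ha)
        (hz'.2 a ha) (hz.2 b hb) (hz'.2 b hb) (hz'.2 κ hc)

/-- There is a walk of length `n` from `x` to `y`. -/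
def Steps (r : V → V → Prop) : ℕ → V → V → Prop
  | 0, x, y => x = y
  | n + 1, x, y => ∃ z, r x z ∧ Steps r n z y

theorem exists_steps {r : V → V → Prop} {x y : V} (h : ReflTransGen r x y) :
    ∃ n, Steps r n x y := by
  induction h using ReflTransGen.head_induction_on with
  | refl => exact ⟨0, rfl⟩
  | head h1 _ ih =>
    obtain ⟨n, hn⟩ := ih
    exact ⟨n + 1, _, h1, hn⟩

/-- A closed walk of length at least seven can be shortened along a chord. -/
theorem Steps.exists_short (hA : Good A) {M : Set V} {x : V} (h : Steps (On A M) (n + 1) x x) :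
    ∃ k < 6, ∃ x, Steps (On A M) (k + 1) x x := by
  induction n using Nat.strong_induction_on generalizing x with
  | _ n ih =>
    by_cases hn : n < 6
    · exact ⟨n, hn, x, h⟩
    obtain ⟨k, rfl⟩ := Nat.exists_eq_add_of_le (not_lt.1 hn)
    rw [show 6 + k + 1 = k + 1 + 1 + 1 + 1 + 1 + 1 + 1 by omega] at h
    obtain ⟨b, ab, c, bc, d, cd, e, de, f, ef, hf⟩ := h
    have arc : ∀ {p q p' q'}, On A M p p' → On A M q q' → A p q → On A M p q :=
      fun h h' h'' => ⟨h.1, h'.1, h''⟩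
    have fM : f ∈ M := ef.2.1
    by_contra hno
    have short : ∀ j < 6 + k, ∀ x, ¬ Steps (On A M) (j + 1) x x := fun j hj x h =>
      hno (ih j hj h)
    refine hA.p6 x b c d e f ab.2.2 bc.2.2 cd.2.2 de.2.2 ef.2.2 ?_ ?_ ?_ ?_ ?_ ?_
    · rintro (h | h)
      · exact short (k + 4) (by omega) x ⟨d, ⟨ab.1, de.1, h⟩, e, de, f, ef, hf⟩
      · exact short 3 (by omega) x ⟨b, ab, c, bc, d, cd, x, ⟨de.1, ab.1, h⟩, rfl⟩
    · rintro (h | h)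
      · exact short (k + 3) (by omega) x ⟨e, ⟨ab.1, ef.1, h⟩, f, ef, hf⟩
      · exact short 4 (by omega) x ⟨b, ab, c, bc, d, cd, e, de, x, ⟨ef.1, ab.1, h⟩, rfl⟩
    · rintro (h | h)
      · exact short (k + 2) (by omega) x ⟨f, ⟨ab.1, fM, h⟩, hf⟩
      · exact short 5 (by omega) x ⟨b, ab, c, bc, d, cd, e, de, f, ef, x, ⟨fM, ab.1, h⟩, rfl⟩
    · rintro (h | h)
      · exact short (k + 4) (by omega) x ⟨b, ab, e, ⟨bc.1, ef.1, h⟩, f, ef, hf⟩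
      · exact short 3 (by omega) b ⟨c, bc, d, cd, e, de, b, ⟨ef.1, bc.1, h⟩, rfl⟩
    · rintro (h | h)
      · exact short (k + 3) (by omega) x ⟨b, ab, f, ⟨bc.1, fM, h⟩, hf⟩
      · exact short 4 (by omega) b ⟨c, bc, d, cd, e, de, f, ef, b, ⟨fM, bc.1, h⟩, rfl⟩
    · rintro (h | h)
      · exact short (k + 4) (by omega) x ⟨b, ab, c, bc, f, ⟨cd.1, fM, h⟩, hf⟩
      · exact short 3 (by omega) c ⟨d, cd, e, de, f, ef, c, ⟨fM, cd.1, h⟩, rfl⟩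

theorem Steps.exists_support (hA : Good A) {M : Set V} {x y : V} (h : Steps (On A M) n x y)
    (hx : x ∈ M) :
    ∃ K ⊆ M, x ∈ K ∧ y ∈ K ∧ Dicol A {z | z ∈ M ∧ ∃ κ ∈ K, Nb A κ z} (n + 1) ∧
      (∀ κ ∈ K, κ = x ∨ ∃ κ' ∈ K, A κ' κ) ∧ (∀ κ ∈ K, κ = y ∨ ∃ κ' ∈ K, A κ κ') ∧
      (n ≠ 0 → (∃ κ ∈ K, A κ y) ∧ ∃ κ ∈ K, A x κ) := by
  induction n generalizing x with
  | zero =>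
    obtain rfl : x = y := h
    refine ⟨{x}, by simpa using hx, rfl, rfl, ?_, fun κ hκ => .inl hκ, fun κ hκ => .inl hκ,
      fun h => absurd rfl h⟩
    exact (dicol_nbhd hA x M).subset fun z hz => ⟨hz.1, by simpa using hz.2⟩
  | succ n ih =>
    obtain ⟨z, hxz, hzy⟩ := h
    obtain ⟨K, hKM, hzK, hyK, hd, hp, hs, hn⟩ := ih hzy hxz.2.1
    refine ⟨insert x K, Set.insert_subset hx hKM, .inl rfl, .inr hyK, ?_, ?_, ?_, ?_⟩
    · refine Dicol.of_subset_union ?_ hd (dicol_nbhd hA x M)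
      rintro w ⟨hw, κ, rfl | hκ, hn⟩
      · exact .inr ⟨hw, hn⟩
      · exact .inl ⟨hw, κ, hκ, hn⟩
    · rintro κ (rfl | hκ)
      · exact .inl rfl
      · rcases hp κ hκ with rfl | ⟨κ', h1, h2⟩
        · exact .inr ⟨x, .inl rfl, hxz.2.2⟩
        · exact .inr ⟨κ', .inr h1, h2⟩
    · rintro κ (rfl | hκ)
      · exact .inr ⟨z, .inr hzK, hxz.2.2⟩
      · exact (hs κ hκ).imp_right fun ⟨κ', h1, h2⟩ => ⟨κ', .inr h1, h2⟩
    · intro _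
      refine ⟨?_, z, .inr hzK, hxz.2.2⟩
      rcases n with _ | n
      · obtain rfl : z = y := hzy
        exact ⟨x, .inl rfl, hxz.2.2⟩
      · obtain ⟨κ, h1, h2⟩ := (hn (by omega)).1
        exact ⟨κ, .inr h1, h2⟩

/-- A short closed walk whose neighbourhood needs few colours. -/
theorem exists_closed_set (hA : Good A) {M : Set V} (hM : StrongOn A M) (hd : ¬ Dicol A M 2) :
    ∃ K ⊆ M, K.Nonempty ∧ Dicol A {z | z ∈ M ∧ ∃ κ ∈ K, Nb A κ z} 7 ∧
      (∀ κ ∈ K, ∃ κ' ∈ K, A κ' κ) ∧ ∀ κ ∈ K, ∃ κ' ∈ K, A κ κ' := by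
  obtain ⟨x, hx⟩ := nonempty_of_not_dicol hd
  obtain ⟨y, hy, hxy⟩ := hM.exists_succ hA hd hx
  obtain ⟨n, hn⟩ := exists_steps (hM y hy x hx)
  obtain ⟨k, hk, x', h⟩ := Steps.exists_short hA (⟨y, ⟨hx, hy, hxy⟩, hn⟩ : Steps _ (n + 1) x x)
  have hx' : x' ∈ M := by
    obtain ⟨z, hz, -⟩ := h
    exact hz.1
  obtain ⟨K, hKM, hxK, -, hdK, hp, hs, hps⟩ := h.exists_support hA hx'
  obtain ⟨h1, h2⟩ := hps (by omega)
  refine ⟨K, hKM, ⟨x', hxK⟩, hdK.mono subset_rfl (by omega), fun κ hκ => ?_, fun κ hκ => ?_⟩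
  · rcases hp κ hκ with rfl | h
    exacts [h1, h]
  · rcases hs κ hκ with rfl | h
    exacts [h2, h]

theorem Good.dicol [Finite V] (hA : Good A) (X : Set V) : Dicol A X 39 := by
  by_contra hX
  obtain ⟨M, -, hM, hdM⟩ := exists_strongOn hX
  obtain ⟨K, hKM, ⟨κ, hκ⟩, hdK, hpred, hsucc⟩ :=
    exists_closed_set hA hM fun h => hdM (h.mono subset_rfl (by norm_num))
  have hdR : ¬ Dicol A (Far A K M) 32 := fun h => hdM <| Dicol.of_subset_union (fun x hx => by
    by_cases hxK : ∃ κ ∈ K, Nb A κ x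
    · exact .inr ⟨hx, hxK⟩
    · exact .inl ⟨hx, fun κ hκ h => hxK ⟨κ, hκ, h⟩⟩) h hdK
  obtain ⟨T, hT, hdT⟩ := exists_isComp hdR
  have hKT : ∀ κ ∈ K, ∀ t ∈ T, ¬ Nb A κ t := fun κ hκ t ht => (hT.subset ht).2 κ hκ
  obtain ⟨t, ht⟩ := nonempty_of_not_dicol hdT
  obtain ⟨g, hg, hκg⟩ := hsucc κ hκ
  rcases exists_frame_or_cycle hA hT (fun h => hdT (h.mono subset_rfl (by norm_num)))
    (fun κ hκ _ _ _ => hpred κ hκ)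
    (fun κ hκ _ _ _ => by
      obtain ⟨κ', h1, h2⟩ := hsucc κ hκ
      exact ⟨κ', h2, hKT κ' h1⟩)
    ⟨κ, hκ, g, hKM hg, hκg, t, ht, hM g (hKM hg) t (hT.subset ht).1⟩ with
    ⟨a, b, c, hF⟩ | ⟨u, -, -, -, ⟨κ₀, hκ₀, κ₁, hκ₁, h01, h1u⟩, q₁, q₂, q₃, hq₃, h1, h2, h3, h4⟩
  · exact hdT ((hF.dicol_of_strongOn hA hT.strong).mono subset_rfl (by norm_num))
  set C : Set V := {u, q₁, q₂, q₃} with hC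
  have hdR' : ¬ Dicol A (Far A C T) 28 := fun h =>
    not_dicol_sdiff_nbhd hA q₃ (not_dicol_sdiff_nbhd hA q₂ (not_dicol_sdiff_nbhd hA q₁
      (not_dicol_sdiff_nbhd hA u hdT))) (h.subset fun x hx => ⟨hx.1.1.1.1, by
        rintro κ (rfl | rfl | rfl | rfl)
        exacts [hx.1.1.1.2, hx.1.1.2, hx.1.2, hx.2]⟩)
  obtain ⟨T', hT', hdT'⟩ := exists_isComp hdR'
  have huC : u ∈ C := .inl rfl
  have h1C : q₁ ∈ C := .inr (.inl rfl)
  have h2C : q₂ ∈ C := .inr (.inr (.inl rfl))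
  have h3C : q₃ ∈ C := .inr (.inr (.inr rfl))
  obtain ⟨t', ht'⟩ := nonempty_of_not_dicol hdT'
  rcases exists_frame_or_cycle hA hT' (fun h => hdT' (h.mono subset_rfl (by norm_num)))
    (by
      rintro κ (rfl | rfl | rfl | rfl) - - -
      exacts [⟨q₃, h3C, h4⟩, ⟨u, huC, h1⟩, ⟨q₁, h1C, h2⟩, ⟨q₂, h2C, h3⟩])
    (by
      have hCT : ∀ κ ∈ C, ∀ t ∈ T', ¬ Nb A κ t := fun κ hκ t ht => (hT'.subset ht).2 κ hκ
      rintro κ (rfl | rfl | rfl | rfl) - - -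
      exacts [⟨q₁, h1, hCT _ h1C⟩, ⟨q₂, h2, hCT _ h2C⟩, ⟨q₃, h3, hCT _ h3C⟩,
        ⟨u, h4, hCT _ huC⟩])
    ⟨q₂, h2C, q₃, hq₃, h3, t', ht', hT.strong q₃ hq₃ t' (hT'.subset ht').1⟩ with
    ⟨a, b, c, hF⟩ | ⟨x, hx, hxC, ⟨z, hz, z', hz', hxz, hzz'⟩, ⟨-, -, κ, hκ, -, hκx⟩, -⟩
  · exact hdT' (hF.dicol_of_strongOn hA hT'.strong)
  have hux : ¬ A u x := fun h => hA.p6 κ₀ κ₁ u x z z' h01 h1u h hxz hzz' (hKT _ hκ₀ _ hx)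
    (hKT _ hκ₀ _ hz.1) (hKT _ hκ₀ _ hz'.1) (hKT _ hκ₁ _ hz.1) (hKT _ hκ₁ _ hz'.1) (hz'.2 _ huC)
  have h1x : ¬ A q₁ x := fun h => hA.p6 κ₁ u q₁ x z z' h1u h1 h hxz hzz' (hKT _ hκ₁ _ hx)
    (hKT _ hκ₁ _ hz.1) (hKT _ hκ₁ _ hz'.1) (hz.2 _ huC) (hz'.2 _ huC) (hz'.2 _ h1C)
  rcases hκ with rfl | rfl | rfl | rfl
  · exact hux hκx
  · exact h1x hκx
  · exact hA.p6 u q₁ κ x z z' h1 h2 hκx hxz hzz' (not_or.2 ⟨hux, hxC _ huC⟩) (hz.2 _ huC)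
      (hz'.2 _ huC) (hz.2 _ h1C) (hz'.2 _ h1C) (hz'.2 _ h2C)
  · exact hA.p6 q₁ q₂ κ x z z' h2 h3 hκx hxz hzz' (not_or.2 ⟨h1x, hxC _ h1C⟩) (hz.2 _ h1C)
      (hz'.2 _ h1C) (hz.2 _ h2C) (hz'.2 _ h2C) (hz'.2 _ h3C)

theorem good_of_isOriented [Finite V] {D : Digraph V} (hD : D.IsOriented)
    (hP : D.InducedFree (Digraph.directedPath 6)) (hω : D.cliqueNumber ≤ 2) : Good D.Adj := by
  classical
  have irr : ∀ u v, Nb D.Adj u v → u ≠ v := by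
    rintro u _ h rfl
    exact h.elim (hD.no_loop u) (hD.no_loop u)
  have tri : ∀ a b c, Nb D.Adj a b → Nb D.Adj b c → Nb D.Adj a c → False := by
    intro a b c h1 h2 h3
    have h : D.toSimpleGraphInclusive.IsNClique 3 {a, b, c} :=
      SimpleGraph.is3Clique_triple_iff.2
        ⟨⟨irr _ _ h1, h1⟩, ⟨irr _ _ h3, h3⟩, ⟨irr _ _ h2, h2⟩⟩
    have := SimpleGraph.IsClique.card_le_cliqueNum (tc := h.isClique)
    rw [h.card_eq] at this
    exact absurd (this.trans hω) (by norm_num)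
  refine ⟨hD.no_two_cycle, tri, ?_⟩
  intro a b c d e f ab bc cd de ef ad ae af be bf cf
  have ac : ¬ Nb D.Adj a c := tri a b c (.inl ab) (.inl bc)
  have bd : ¬ Nb D.Adj b d := tri b c d (.inl bc) (.inl cd)
  have ce : ¬ Nb D.Adj c e := tri c d e (.inl cd) (.inl de)
  have df : ¬ Nb D.Adj d f := tri d e f (.inl de) (.inl ef)
  have ba := hD.no_two_cycle _ _ ab
  have cb := hD.no_two_cycle _ _ bc
  have dc := hD.no_two_cycle _ _ cd
  have ed := hD.no_two_cycle _ _ de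
  have fe := hD.no_two_cycle _ _ ef
  have irr' := hD.no_loop
  simp only [Nb, not_or] at *
  have hiff : ∀ i j : Fin 6, D.Adj (![a, b, c, d, e, f] i) (![a, b, c, d, e, f] j) ↔
      i.val + 1 = j.val := by
    intro i j
    fin_cases i <;> fin_cases j <;> simp [*]
  refine hP.false ⟨⟨![a, b, c, d, e, f], fun i j hij => ?_⟩, hiff _ _⟩
  have key : ∀ i j : Fin 6, ![a, b, c, d, e, f] i = ![a, b, c, d, e, f] j → ¬ i.val < j.val := by
    intro i j hij hlt
    have hi : i.val + 1 < 6 := by omega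
    have h1 := (hiff i ⟨i.val + 1, hi⟩).2 rfl
    rw [hij, hiff] at h1
    simp only at h1
    omega
  exact Fin.ext (le_antisymm (not_lt.1 (key j i hij.symm)) (not_lt.1 (key i j hij)))

theorem dicolourable_of_dicol {D : Digraph V} (h : Dicol D.Adj Set.univ n) :
    D.Dicolourable n := by
  obtain ⟨f, hf, hac⟩ := h
  refine ⟨fun v => ⟨f v, hf v trivial⟩, fun i k hk c hc => ?_⟩
  set S : Set V := {x | x ∈ Set.univ ∧ f x = i} with hS
  have hmem : ∀ j, (c j : V) ∈ S := fun j => ⟨trivial, congrArg Fin.val (c j).2⟩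
  have walk : ∀ j : ℕ, TransGen (On D.Adj S) (c 0 : V) (c (Fin.ofNat k (j + 1))) := by
    intro j
    induction j with
    | zero =>
      have h1 : Fin.ofNat k (0 + 1) = 0 + 1 := by
        ext
        simp
      rw [h1]
      exact .single ⟨hmem _, hmem _, hc.2 0⟩
    | succ j ih =>
      refine ih.tail ⟨hmem _, hmem _, ?_⟩
      have h1 : Fin.ofNat k (j + 1) + 1 = Fin.ofNat k (j + 1 + 1) := by
        ext
        simp [Fin.val_add]
      rw [← h1]
      exact hc.2 _
  have := walk (k - 1)
  rw [Nat.sub_add_cancel (Nat.one_le_iff_ne_zero.2 hk.out), show Fin.ofNat k k = 0 by ext; simp] at this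
  exact hac i _ this

end OrientedColouring

theorem theorem1p3 {V : Type*} [Finite V] (D : Digraph V) (hD : D.IsOriented)
    (hP : D.InducedFree (Digraph.directedPath 6)) (hω : D.cliqueNumber ≤ 2) :
    D.dichromaticNumber ≤ 382 := by
  have h : D.Dicolourable 382 := OrientedColouring.dicolourable_of_dicol
    (((OrientedColouring.good_of_isOriented hD hP hω).dicol Set.univ).mono subset_rfl
      (by norm_num))
  exact iInf₂_le 382 h
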